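/- **Conventions.** A multisorted relational signature $\Sigma$ consists of finitely many types and finitely many relational symbols $R$, each with an arity $\mathrm{ar}_R$, a finite (possibly empty) tuple of types. A $\Sigma$-structure $\mathbf A$ has a domain $A_t$ for each type $t$ (domains of distinct types are regarded as disjoint) and a relation $R^{\mathbf A}\subseteq A_{\mathrm{ar}_R(1)}\times\dots\times A_{\mathrm{ar}_R(k)}$ for each symbol $R$, where $k$ is the length of $\mathrm{ar}_R$. Homomorphisms are maps preserving types and all relations; $\mathbf X\to\mathbf A$ means that one exists. $\mathrm{CSP}(\mathbf A)$ is the problem to decide, for a given finite structure $\mathbf X$ of the same signature as $\mathbf A$, whether $\mathbf X\to\mathbf A$. For a finite Abelian group $\mathbb G$, $\mathrm{CSP}(\mathbb G)$ is the CSP whose template is the single-sorted structure with domain $G$, the ternary relation $\{(x_1,x_2,y) : x_1+x_2=y\}$, and for each $b\in G$ the unary relation $\{y : y=b\}$. (So $\mathrm{CSP}(\mathbb Z_p)$ is the problem of solving systems of linear equations modulo $p$.) **Datalog$^\cup$ reductions.** A *Datalog program* with input signature $\Pi$ consists of a signature $\Delta\supseteq\Pi$ with the same types, a finite set of rules $t_0\leftarrow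 t_1,\dots,t_r$ in typed variables, where $t_1,\dots,t_r$ are atomic $\Delta$-formulae (equalities allowed) and $t_0=R(x_1,\dots,x_m)$ with $R$ in $\Delta\setminus\Pi$, and a designated output symbol in $\Delta$. On a $\Pi$-structure $\mathbf A$ it outputs the relation that the output symbol receives in the least fixed point of the rules. The arity of the program is the arity of its output symbol. A *Datalog interpretation* $\phi$ from $\Pi$-structures to $\Sigma$-structures consists of Datalog programs $\phi_t$ for each $\Sigma$-type $t$ and $\phi_R$ for each $\Sigma$-symbol $R$, all with input signature $\Pi$, such that the arity of $\phi_R$ is the concatenation of the arities of $\phi_{\mathrm{ar}_R(1)},\dots,\phi_{\mathrm{ar}_R(k)}$. The structure $\phi(\mathbf A)$ has domains $\phi_t(\mathbf A)$, and its relation $R$ consists of those tuples of $\phi_{\mathrm{ar}_R(1)}(\mathbf A)\times\dots\times\phi_{\mathrm{ar}_R(k)}(\mathbf A)$ whose concatenation lies in $\phi_R(\mathbf A)$. A *union gadget* $\upsilon$ from $\Pi$ to $\Sigma$ is a pair of maps $(d,r)$, where $d$ maps $\Pi$-types to $\Sigma$-types and $r$ maps $\Pi$-symbols to $\Sigma$-symbols,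 such that $\mathrm{ar}_{r(R)}=d\circ\mathrm{ar}_R$ for all $R$. The structure $\upsilon(\mathbf A)$ has as its $t$-th domain the disjoint union of all $A_i$ with $d(i)=t$, and $S^{\upsilon(\mathbf A)}=\bigcup_{r(R)=S}R^{\mathbf A}$. Write $\mathrm{CSP}(\mathbf A)\leq_{\mathrm{DL}}\mathrm{CSP}(\mathbf B)$ if there are a Datalog interpretation $\phi$ (into structures of some signature) and a union gadget $\upsilon$ such that, for every finite structure $\mathbf X$ of the signature of $\mathbf A$, $\mathbf X\to\mathbf A$ implies $\upsilon(\phi(\mathbf X))\to\mathbf B$, and $\mathbf X\not\to\mathbf A$ implies $\upsilon(\phi(\mathbf X))\not\to\mathbf B$. **Proposition.** For all primes $p\neq q$, $\mathrm{CSP}(\mathbb Z_p)\not\leq_{\mathrm{DL}}\mathrm{CSP}(\mathbb Z_q)$. -/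

import Mathlib

namespace DatalogCSP

/-- A multisorted relational signature: a set of types, a set of relational symbols, and for each
symbol its arity, a tuple of types. -/
structure Signature where
  Ty : Type
  Sym : Type
  ar : Sym → List Ty

/-- A finite signature: finitely many types and finitely many symbols. -/
def Signature.IsFinite (S : Signature) : Prop := Finite S.Ty ∧ Finite S.Sym

/-- A multisorted relational structure of signature `S`. The (pairwise disjoint) domains `A_t` are
presented together: `El` is the set of all elements, `ty x` is the type of the element `x`, and the
domain of type `t` is `{x | ty x = t}`. The relation `rel R` is a set of tuples, and the tuples in
it have the types prescribed by the arity of `R`. -/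
structure RelStr (S : Signature) where
  El : Type
  ty : El → S.Ty
  rel : S.Sym → Set (List El)
  typed : ∀ R w, w ∈ rel R → w.map ty = S.ar R

/-- `f` is a homomorphism: it preserves types and all relations. -/
def IsHom {S : Signature} (A B : RelStr S) (f : A.El → B.El) : Prop :=
  (∀ x, B.ty (f x) = A.ty x) ∧ ∀ R, ∀ w ∈ A.rel R, w.map f ∈ B.rel R

/-- `A → B`: there is a homomorphism from `A` to `B`. -/
def Maps {S : Signature} (A B : RelStr S) : Prop := ∃ f : A.El → B.El, IsHom A B f

/-! ### Datalog -/

/-- The extension of the signature `S` by new symbols, with the same types. -/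
def Signature.extend (S : Signature) (IDB : Type) (arI : IDB → List S.Ty) : Signature where
  Ty := S.Ty
  Sym := S.Sym ⊕ IDB
  ar := Sum.elim S.ar arI

/-- Atomic formulae `R(x₁, …, xₙ)` and `x = y` with symbols in `Sym` and variables in `V`. -/
inductive Atom (Sym V : Type) where
  | rel (R : Sym) (args : List V) : Atom Sym V
  | eq (x y : V) : Atom Sym V

/-- The variables that occur in an atomic formula. -/
def Atom.vars {Sym V : Type} : Atom Sym V → List V
  | .rel _ args => args
  | .eq x y => [x, y]

/-- The atomic formula respects the types, where the variable `x` has type `vty x`. -/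
def Atom.WellTyped {D : Signature} {V : Type} (vty : V → D.Ty) : Atom D.Sym V → Prop
  | .rel R args => args.map vty = D.ar R
  | .eq x y => vty x = vty y

/-- A Datalog rule `t₀ ← t₁, …, tᵣ`, in the variables `Fin n`, each of which has a type and occurs
in the rule. The head `t₀` is `head(headArgs)` with `head` one of the new symbols; the body is a
list of atomic formulae over the extended signature. -/
structure Rule (S : Signature) (IDB : Type) (arI : IDB → List S.Ty) where
  n : ℕ
  vty : Fin n → S.Ty
  head : IDB
  headArgs : List (Fin n)
  head_typed : headArgs.map vty = arI head
  body : List (Atom (S.extend IDB arI).Sym (Fin n))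
  body_typed : ∀ a ∈ body, a.WellTyped (D := S.extend IDB arI) vty
  occurs : ∀ x : Fin n, x ∈ headArgs ∨ ∃ a ∈ body, x ∈ a.vars

/-- A Datalog program with input signature `S`: finitely many new symbols (IDBs), finitely many
rules, and one symbol (new, or of the input signature) designated as output. -/
structure Program (S : Signature) where
  IDB : Type
  finite_IDB : Finite IDB
  arI : IDB → List S.Ty
  rules : List (Rule S IDB arI)
  out : (S.extend IDB arI).Sym

/-- The arity of a Datalog program is the arity of its output symbol. -/
def Program.arity {S : Signature} (P : Program S) : List S.Ty :=
  (S.extend P.IDB P.arI).ar P.out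

/-- The fixed-point semantics: `P.Derives A R w` means that the tuple `w` is in the relation `R`
of the least fixed point of the program `P` on the input structure `A`. -/
inductive Program.Derives {S : Signature} (P : Program S) (A : RelStr S) :
    (S.extend P.IDB P.arI).Sym → List A.El → Prop
  | edb (R : S.Sym) (w : List A.El) (hw : w ∈ A.rel R) : Program.Derives P A (Sum.inl R) w
  | rule (r : Rule S P.IDB P.arI) (hr : r ∈ P.rules) (h : Fin r.n → A.El)
      (hty : ∀ x, A.ty (h x) = r.vty x)
      (hrel : ∀ R args, Atom.rel R args ∈ r.body → Program.Derives P A R (args.map h))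
      (heq : ∀ x y, Atom.eq x y ∈ r.body → h x = h y) :
      Program.Derives P A (Sum.inr r.head) (r.headArgs.map h)

/-- The output relation `P(A)`. -/
def Program.output {S : Signature} (P : Program S) (A : RelStr S) : Set (List A.El) :=
  {w | P.Derives A P.out w}

/-- A Datalog interpretation mapping `S`-structures to `T`-structures. The arity of the program
for a symbol `R` is the concatenation of the arities of the programs for the types in `ar R`. -/
structure Interpretation (S T : Signature) where
  tyProg : T.Ty → Program S
  symProg : T.Sym → Program S
  arity_eq : ∀ R, (symProg R).arity = (T.ar R).flatMap fun t => (tyProg t).arity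

/-- The `T`-structure `φ(A)`: the domain of type `t` is the output of the program for `t`, and a
tuple of such tuples is in `R` iff their concatenation is in the output of the program for `R`. -/
def Interpretation.apply {S T : Signature} (φ : Interpretation S T) (A : RelStr S) :
    RelStr T where
  El := (t : T.Ty) × {w : List A.El // w ∈ (φ.tyProg t).output A}
  ty := fun x => x.1
  rel := fun R => {v | v.map (fun x => x.1) = T.ar R ∧
    (v.flatMap fun x => x.2.1) ∈ (φ.symProg R).output A}
  typed := fun _ _ hv => hv.1

/-- A union gadget from `S` to `T`: a map of types and a map of symbols compatible with arities. -/
structure UnionGadget (S T : Signature) where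
  d : S.Ty → T.Ty
  r : S.Sym → T.Sym
  arity_eq : ∀ R, T.ar (r R) = (S.ar R).map d

/-- The `T`-structure `υ(A)`: the domain of type `t` is the disjoint union of the domains of the
types `i` with `d i = t`, and the relation `Q` is the union of the relations `R` with `r R = Q`. -/
def UnionGadget.apply {S T : Signature} (υ : UnionGadget S T) (A : RelStr S) : RelStr T where
  El := A.El
  ty := fun x => υ.d (A.ty x)
  rel := fun Q => {w | ∃ R, υ.r R = Q ∧ w ∈ A.rel R}
  typed := by
    rintro Q w ⟨R, rfl, hw⟩
    rw [υ.arity_eq, ← A.typed R w hw, List.map_map]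
    rfl

/-! ### Reductions between (promise) CSPs -/

/-- `ψ` is a reduction from `PCSP(A, A')` to `PCSP(B, B')`: on every finite instance `X` it is
complete and sound. -/
def IsReduction {S T : Signature} (ψ : RelStr S → RelStr T) (A A' : RelStr S) (B B' : RelStr T) :
    Prop :=
  ∀ X : RelStr S, Finite X.El →
    (Maps X A → Maps (ψ X) B) ∧ (¬ Maps X A' → ¬ Maps (ψ X) B')

/-- `PCSP(A, A') ≤_DL PCSP(B, B')`: some composition of a Datalog interpretation into a finite
signature `M` with a union gadget is a reduction. -/
def PCSPLeDL {S T : Signature} (A A' : RelStr S) (B B' : RelStr T) : Prop :=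
  ∃ (M : Signature) (_ : M.IsFinite) (φ : Interpretation S M) (υ : UnionGadget M T),
    IsReduction (fun X => υ.apply (φ.apply X)) A A' B B'

/-- `CSP(A) ≤_DL CSP(B)`, where `CSP(A)` is `PCSP(A, A)`. -/
def CSPLeDL {S T : Signature} (A : RelStr S) (B : RelStr T) : Prop :=
  PCSPLeDL A A B B

/-! ### The CSP of a group -/

/-- The relational symbols of the template of an Abelian group: `x₁ + x₂ = y`, and `y = b` for
each group element `b`. -/
inductive GroupSym (G : Type) where
  | add : GroupSym G
  | const (b : G) : GroupSym G

/-- The single-sorted signature of systems of linear equations over `G`. -/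
def groupSig (G : Type) : Signature where
  Ty := Unit
  Sym := GroupSym G
  ar := fun R => match R with
    | .add => [(), (), ()]
    | .const _ => [()]

/-- The relations of the template of `CSP(G)`. -/
def groupRel (G : Type) [AddCommGroup G] : GroupSym G → Set (List G)
  | .add => {w | ∃ x₁ x₂ y : G, w = [x₁, x₂, y] ∧ x₁ + x₂ = y}
  | .const b => {w | ∃ y : G, w = [y] ∧ y = b}

/-- The template of `CSP(G)`. -/
def groupTemplate (G : Type) [AddCommGroup G] : RelStr (groupSig G) where
  El := G
  ty := fun _ => ()
  rel := groupRel G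
  typed := by
    rintro (_ | b) w hw
    · obtain ⟨x₁, x₂, y, rfl, -⟩ := hw
      rfl
    · obtain ⟨y, rfl, -⟩ := hw
      rfl

end DatalogCSP

open Finset

namespace DatalogCSP

/-! Datalog sees only boundedly many elements at a time, and averages of solutions over `ZMod q` are
again solutions when their number is prime to `q`. Suppose a reduction exists whose programs have
width at most `k`. Take an unsolvable system over `ZMod p` on a torus of side greater than `k`. It
becomes solvable once a single equation is relaxed, and this defect can be moved away from any `k`
variables without changing their values (`exists_isFlow`). Solutions with one defect therefore carry
Datalog derivations on the system to derivations on the template (`LocalSolutions.derives`). The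
template maps to itself, so its image has a solution over `ZMod q`. Pulling this solution back along
all solutions with a fixed defect and averaging solves the image of the unsolvable system
(`LocalSolutions.maps`), against soundness. The division is legitimate because these solutions form
a coset of a `p`-group (`card_torusSol_dvd`). -/

/-! ### Systems of local solutions -/

/-- A family of sets of maps `X → A`, each of which is a local homomorphism away from an obstacle
`v`. Every set of at most `k` elements avoids some obstacle, and any two obstacles that are avoided
by a set can be exchanged without changing the maps on this set. -/
structure LocalSolutions {S : Signature} (X A : RelStr S) (k : ℕ) where
  Obstacle : Type
  sol : Obstacle → Finset (X.El → A.El)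
  Avoids : Set X.El → Obstacle → Prop
  mono : ∀ {K L v}, K ⊆ L → Avoids L v → Avoids K v
  exists_avoids : ∀ K : Set X.El, K.Finite → K.ncard ≤ k → ∃ v, Avoids K v
  move : ∀ {K v v'}, Avoids K v → Avoids K v' → ∃ e : (X.El → A.El) → (X.El → A.El),
    Set.BijOn e (sol v) (sol v') ∧ ∀ f, Set.EqOn (e f) f K
  ty_eq : ∀ {v}, ∀ f ∈ sol v, ∀ x, A.ty (f x) = X.ty x
  map_rel : ∀ {v} {R : S.Sym} {w}, w ∈ X.rel R → Avoids {x | x ∈ w} v →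
    ∀ f ∈ sol v, w.map f ∈ A.rel R

section Averaging

variable {S : Signature} {X A : RelStr S} {k : ℕ}

/-- Datalog derivations in few variables are preserved by local solutions. -/
theorem LocalSolutions.derives (F : LocalSolutions X A k) (P : Program S)
    (hP : ∀ r ∈ P.rules, r.n ≤ k) {R : (S.extend P.IDB P.arI).Sym} {w : List X.El}
    (hw : P.Derives X R w) {v : F.Obstacle} (hv : F.Avoids {x | x ∈ w} v)
    {f : X.El → A.El} (hf : f ∈ F.sol v) : P.Derives A R (w.map f) := by
  induction hw generalizing v f with
  | edb R w hw => exact .edb R _ (F.map_rel hw hv f hf)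
  | rule r hr h hty hrel heq ih =>
    -- The obstacle `v` may meet body variables that are absent from the head. It is exchanged for
    -- one that misses the whole rule, keeping the values on the head.
    obtain ⟨v', hv'⟩ := F.exists_avoids (Set.range h) (Set.finite_range h) <| by
      refine le_trans ?_ (hP r hr)
      rw [← Set.image_univ]
      refine (Set.ncard_image_le Set.finite_univ).trans ?_
      simp [Set.ncard_univ]
    have hsub : ∀ l : List (Fin r.n), {x | x ∈ l.map h} ⊆ Set.range h := by
      intro l x hx
      obtain ⟨a, -, rfl⟩ := List.mem_map.1 hx
      exact ⟨a, rfl⟩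
    obtain ⟨e, he, heq'⟩ := F.move hv (F.mono (hsub _) hv')
    have hef : e f ∈ F.sol v' := he.mapsTo hf
    have key : (r.headArgs.map h).map f = r.headArgs.map (e f ∘ h) := by
      rw [← List.map_map]
      exact List.map_congr_left fun x hx => (heq' f hx).symm
    rw [key]
    refine .rule r hr (e f ∘ h) (fun x => (F.ty_eq _ hef _).trans (hty x)) ?_ ?_
    · intro R args hR
      rw [← List.map_map]
      exact ih R args hR (F.mono (hsub _) hv') hef
    · intro x y hxy
      exact congrArg (e f) (heq x y hxy)

/-- Derived tuples have the prescribed length. -/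
theorem Program.Derives.length_eq {P : Program S} {R : (S.extend P.IDB P.arI).Sym}
    {w : List X.El} (hw : P.Derives X R w) :
    w.length = ((S.extend P.IDB P.arI).ar R).length := by
  cases hw with
  | edb R w hw =>
    rw [← List.length_map X.ty, X.typed R w hw]
    rfl
  | rule r hr h hty hrel heq =>
    rw [List.length_map, ← List.length_map r.vty, r.head_typed]
    rfl

theorem LocalSolutions.exists_avoids_list (F : LocalSolutions X A k) (w : List X.El)
    (hw : w.length ≤ k) : ∃ v, F.Avoids {x | x ∈ w} v := by
  classical
  have h : {x | x ∈ w} = (w.toFinset : Set X.El) := by ext; simp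
  refine F.exists_avoids _ (h ▸ w.toFinset.finite_toSet) ?_
  rw [h, Set.ncard_coe_finset]
  exact (List.toFinset_card_le w).trans hw

/-- All rules of the programs in a Datalog interpretation have at most `k` variables, and the
output symbols have arity at most `k`. -/
def Interpretation.WidthLE {T : Signature} (φ : Interpretation S T) (k : ℕ) : Prop :=
  (∀ t, (φ.tyProg t).arity.length ≤ k ∧ ∀ r ∈ (φ.tyProg t).rules, r.n ≤ k) ∧
    ∀ R, (φ.symProg R).arity.length ≤ k ∧ ∀ r ∈ (φ.symProg R).rules, r.n ≤ k

theorem exists_width_bound {ι : Type} [Finite ι] (P : ι → Program S) :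
    ∃ k, ∀ i, (P i).arity.length ≤ k ∧ ∀ r ∈ (P i).rules, r.n ≤ k := by
  have h : ∀ i, ∃ k, (P i).arity.length ≤ k ∧ ∀ r ∈ (P i).rules, r.n ≤ k := fun i =>
    ⟨(P i).arity.length + ((P i).rules.map fun r => r.n).sum, Nat.le_add_right _ _, fun r hr =>
      (List.le_sum_of_mem (List.mem_map_of_mem hr)).trans (Nat.le_add_left _ _)⟩
  choose b hb using h
  obtain ⟨k, hk⟩ := (Set.finite_range b).bddAbove
  exact ⟨k, fun i => ⟨(hb i).1.trans (hk ⟨i, rfl⟩), fun r hr => ((hb i).2 r hr).trans (hk ⟨i, rfl⟩)⟩⟩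

/-- Finiteness of the intermediate signature gives one bound for all programs; it fixes the size of
the torus. -/
theorem Interpretation.exists_widthLE {T : Signature} (hT : T.IsFinite)
    (φ : Interpretation S T) : ∃ k, φ.WidthLE k := by
  have := hT.1
  have := hT.2
  obtain ⟨k, hk⟩ := exists_width_bound φ.tyProg
  obtain ⟨l, hl⟩ := exists_width_bound φ.symProg
  refine ⟨max k l, fun t => ⟨(hk t).1.trans (le_max_left _ _), fun r hr => ?_⟩,
    fun R => ⟨(hl R).1.trans (le_max_right _ _), fun r hr => ?_⟩⟩
  · exact ((hk t).2 r hr).trans (le_max_left _ _)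
  · exact ((hl R).2 r hr).trans (le_max_right _ _)

/-! ### Averaging over local solutions -/

theorem mem_groupRel_add {G : Type} [AddCommGroup G] {a b c : G} :
    [a, b, c] ∈ groupRel G .add ↔ a + b = c := by
  refine ⟨?_, fun h => ⟨a, b, c, rfl, h⟩⟩
  rintro ⟨x, y, z, hl, h⟩
  simp only [List.cons.injEq, and_true] at hl
  obtain ⟨rfl, rfl, rfl⟩ := hl
  exact h

theorem mem_groupRel_const {G : Type} [AddCommGroup G] {a b : G} :
    [a] ∈ groupRel G (.const b) ↔ a = b := by
  refine ⟨?_, fun h => ⟨a, rfl, h⟩⟩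
  rintro ⟨y, hl, h⟩
  simp only [List.cons.injEq, and_true] at hl
  exact hl.trans h

/-- The relations of the template of `CSP(ZMod q)` are closed under averages over index sets whose
size is not divisible by `q`. -/
theorem groupRel_average {q : ℕ} [Fact q.Prime] {ι α : Type} (s : Finset ι)
    (hs : (s.card : ZMod q) ≠ 0) (G : α → ι → ZMod q) (Q : GroupSym (ZMod q)) (l : List α)
    (h : ∀ f ∈ s, l.map (fun x => G x f) ∈ groupRel (ZMod q) Q) :
    l.map (fun x => (s.card : ZMod q)⁻¹ * ∑ f ∈ s, G x f) ∈ groupRel (ZMod q) Q := by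
  have hne : s.Nonempty := by
    rw [Finset.nonempty_iff_ne_empty]
    rintro rfl
    simp at hs
  obtain ⟨f₀, hf₀⟩ := hne
  cases Q with
  | add =>
    obtain ⟨a, b, c, hl, -⟩ := h f₀ hf₀
    obtain ⟨x, y, z, rfl⟩ := List.length_eq_three.1
      (show l.length = 3 by simpa using congrArg List.length hl)
    have h' : ∀ f ∈ s, G x f + G y f = G z f := fun f hf => mem_groupRel_add.1 (h f hf)
    refine mem_groupRel_add.2 ?_
    rw [← mul_add, ← Finset.sum_add_distrib, Finset.sum_congr rfl h']
  | const b =>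
    obtain ⟨a, hl, -⟩ := h f₀ hf₀
    obtain ⟨x, rfl⟩ := List.length_eq_one_iff.1
      (show l.length = 1 by simpa using congrArg List.length hl)
    have h' : ∀ f ∈ s, G x f = b := fun f hf => mem_groupRel_const.1 (h f hf)
    refine mem_groupRel_const.2 ?_
    beta_reduce
    -- The constants require the weights to sum to `1`, hence the invertible cardinality.
    rw [Finset.sum_congr rfl h', Finset.sum_const, nsmul_eq_mul, inv_mul_cancel_left₀ hs]

open Classical in
open Classical in
/-- The value of `g` at the element `w` of type `t`, if there is such an element. -/
noncomputable def Interpretation.valueAt {T : Signature} (φ : Interpretation S T) {B : Type}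
    [Zero B] (g : (φ.apply A).El → B) (t : T.Ty) (w : List A.El) : B :=
  if h : w ∈ (φ.tyProg t).output A then g ⟨t, w, h⟩ else 0

theorem Interpretation.valueAt_eq {T : Signature} (φ : Interpretation S T) {B : Type} [Zero B]
    (g : (φ.apply A).El → B) {t : T.Ty} {w : List A.El} (h : w ∈ (φ.tyProg t).output A) :
    φ.valueAt g t w = g ⟨t, w, h⟩ := by
  rw [valueAt, dif_pos h]

theorem Interpretation.exists_map_eq {T : Signature} (φ : Interpretation S T) {B : Type} [Zero B]
    (g : (φ.apply A).El → B) (f : X.El → A.El) (l : List (φ.apply X).El)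
    (h : ∀ x ∈ l, x.2.1.map f ∈ (φ.tyProg x.1).output A) :
    ∃ l' : List (φ.apply A).El, l'.map (fun x => x.1) = l.map (fun x => x.1) ∧
      (l'.flatMap fun x => x.2.1) = (l.flatMap fun x => x.2.1).map f ∧
      l'.map g = l.map fun x => φ.valueAt g x.1 (x.2.1.map f) := by
  induction l with
  | nil => exact ⟨[], rfl, rfl, rfl⟩
  | cons x l ih =>
    obtain ⟨l', h₁, h₂, h₃⟩ := ih fun y hy => h y (List.mem_cons_of_mem _ hy)
    have hx := h x List.mem_cons_self
    exact ⟨⟨x.1, x.2.1.map f, hx⟩ :: l', congrArg (x.1 :: ·) h₁,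
      (congrArg (x.2.1.map f ++ ·) h₂).trans List.map_append.symm,
      congrArg₂ List.cons (φ.valueAt_eq g hx).symm h₃⟩

/-- If the sets of local solutions have sizes prime to `q`, then a solution over `ZMod q` of the
image of the template yields a solution of the image of the instance. -/
theorem LocalSolutions.maps {q : ℕ} [Fact q.Prime] (F : LocalSolutions X A k)
    (hF : ∀ v, ((F.sol v).card : ZMod q) ≠ 0) {M : Signature} (φ : Interpretation S M)
    (hφ : φ.WidthLE k) (υ : UnionGadget M (groupSig (ZMod q)))
    (hA : Maps (υ.apply (φ.apply A)) (groupTemplate (ZMod q))) :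
    Maps (υ.apply (φ.apply X)) (groupTemplate (ZMod q)) := by
  obtain ⟨g, -, hg⟩ := hA
  have hex : ∀ x : (φ.apply X).El, ∃ v, F.Avoids {y | y ∈ x.2.1} v := fun x =>
    F.exists_avoids_list _ ((Program.Derives.length_eq x.2.2).le.trans (hφ.1 x.1).1)
  choose o ho using hex
  -- The default `0` in `valueAt` is never reached when the obstacle of `f` is avoided by `x`, by
  -- `derives`.
  let G : (φ.apply X).El → (X.El → A.El) → ZMod q := fun x f => φ.valueAt (B := ZMod q) g x.1 (x.2.1.map f)
  -- The average at `x` does not depend on the avoided obstacle, since the exchange bijection fixes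
  -- values on `x`.
  have hG : ∀ (x : (φ.apply X).El) (v : F.Obstacle), F.Avoids {y | y ∈ x.2.1} v →
      ((F.sol (o x)).card : ZMod q)⁻¹ * ∑ f ∈ F.sol (o x), G x f =
        ((F.sol v).card : ZMod q)⁻¹ * ∑ f ∈ F.sol v, G x f := by
    intro x v hv
    obtain ⟨e, he, hef⟩ := F.move (ho x) hv
    have hcard : (F.sol (o x)).card = (F.sol v).card :=
      Finset.card_bij (fun f _ => e f) (fun f hf => he.mapsTo hf)
        (fun f hf f' hf' h => he.injOn hf hf' h)
        (fun f hf => let ⟨f', hf', h⟩ := he.surjOn hf; ⟨f', hf', h⟩)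
    rw [hcard]
    congr 1
    refine Finset.sum_bij (fun f _ => e f) (fun f hf => he.mapsTo hf)
        (fun f hf f' hf' h => he.injOn hf hf' h)
        (fun f hf => let ⟨f', hf', h⟩ := he.surjOn hf; ⟨f', hf', h⟩) fun f _ => ?_
    have hm : x.2.1.map (e f) = x.2.1.map f := List.map_congr_left fun y hy => hef f hy
    exact congrArg (φ.valueAt (B := ZMod q) g x.1) hm.symm
  refine ⟨fun x => ((F.sol (o x)).card : ZMod q)⁻¹ * ∑ f ∈ F.sol (o x), G x f, fun _ => rfl, ?_⟩
  rintro Q (l : List (φ.apply X).El) ⟨R, rfl, hl, hlR⟩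
  -- The concatenated tuple has length at most `k`, so one obstacle serves all its entries and their
  -- averages run over a common set.
  obtain ⟨v, hv⟩ := F.exists_avoids_list _
    ((Program.Derives.length_eq hlR).le.trans (hφ.2 R).1)
  have hsub : ∀ x ∈ l, F.Avoids {y | y ∈ x.2.1} v := fun x hx =>
    F.mono (fun y hy => List.mem_flatMap.2 ⟨x, hx, hy⟩) hv
  have hmap : l.map (fun x => ((F.sol (o x)).card : ZMod q)⁻¹ * ∑ f ∈ F.sol (o x), G x f) =
      l.map (fun x => ((F.sol v).card : ZMod q)⁻¹ * ∑ f ∈ F.sol v, G x f) :=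
    List.map_congr_left fun x hx => hG x v (hsub x hx)
  refine Set.mem_of_eq_of_mem hmap (groupRel_average (F.sol v) (hF v) G (υ.r R) l fun f hf => ?_)
  obtain ⟨l', h₁, h₂, h₃⟩ := φ.exists_map_eq (B := ZMod q) g f l fun x hx =>
    F.derives _ (hφ.1 x.1).2 x.2.2 (hsub x hx) hf
  refine Set.mem_of_eq_of_mem h₃.symm (hg (υ.r R) l' ⟨R, rfl, h₁.trans hl, ?_⟩)
  exact Set.mem_of_eq_of_mem h₂ (F.derives _ (hφ.2 R).2 hlR hv hf)

end Averaging

/-! ### An unsolvable system of equations on the torus -/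

/-- The positions on the discrete torus. -/
abbrev Torus (n : ℕ) := ZMod n × ZMod n

/-- An unsolvable system of equations over `ZMod p`, with five variables `x₀, …, x₄` at each
position `g` of a torus, and the equations `x₀(g) + x₁(g) = x₂(g)`, `x₂(g) + x₄(g) = x₃(g)`,
`x₀(g) + x₁(g - (1, 0)) = x₃(g - (0, 1))`, where `x₄(g)` is `1` at `g = 0` and `0` elsewhere. -/
def torusSystem (p n : ℕ) : RelStr (groupSig (ZMod p)) where
  El := Fin 5 × Torus n
  ty := fun _ => ()
  rel := fun R => match R with
    | .add => {w | ∃ g : Torus n, w = [(0, g), (1, g), (2, g)] ∨ w = [(2, g), (4, g), (3, g)] ∨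
        w = [(0, g), (1, g - (1, 0)), (3, g - (0, 1))]}
    | .const b => {w | ∃ g : Torus n, w = [(4, g)] ∧ (Pi.single 0 1 : Torus n → ZMod p) g = b}
  typed := by
    rintro (_ | b) w hw
    · obtain ⟨g, rfl | rfl | rfl⟩ := hw <;> rfl
    · obtain ⟨g, rfl, -⟩ := hw
      rfl

/-- Summed over the torus, the shifts disappear: `Σx₀ + Σx₁ = Σx₂`, `Σx₂ + 1 = Σx₃` and `Σx₀ + Σx₁ =
Σx₃`, so `1 = 0`. -/
theorem not_maps_torusSystem {p n : ℕ} (hp : p.Prime) [NeZero n] :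
    ¬ Maps (torusSystem p n) (groupTemplate (ZMod p)) := by
  rintro ⟨f, -, hf⟩
  have : Fact p.Prime := ⟨hp⟩
  let f' : Fin 5 × Torus n → ZMod p := f
  have hadd : ∀ a b c : Fin 5 × Torus n,
      [a, b, c] ∈ (torusSystem p n).rel .add → f' a + f' b = f' c :=
    fun a b c h => mem_groupRel_add.1 (hf .add [a, b, c] h)
  have h₁ : ∀ g, f' (0, g) + f' (1, g) = f' (2, g) := fun g => hadd _ _ _ ⟨g, .inl rfl⟩
  have h₂ : ∀ g, f' (2, g) + f' (4, g) = f' (3, g) := fun g => hadd _ _ _ ⟨g, .inr (.inl rfl)⟩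
  have h₃ : ∀ g, f' (0, g) + f' (1, g - (1, 0)) = f' (3, g - (0, 1)) := fun g =>
    hadd _ _ _ ⟨g, .inr (.inr rfl)⟩
  have h₄ : ∀ g, f' (4, g) = (Pi.single 0 1 : Torus n → ZMod p) g := fun g =>
    mem_groupRel_const.1 (hf (.const _) [(4, g)] ⟨g, rfl, rfl⟩)
  have e₁ := Fintype.sum_congr _ _ h₁
  have e₂ := Fintype.sum_congr _ _ h₂
  have e₃ := Fintype.sum_congr _ _ h₃
  have e₄ := Fintype.sum_congr _ _ h₄
  rw [Finset.sum_add_distrib] at e₁ e₂ e₃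
  have e₅ := (Equiv.subRight ((1, 0) : Torus n)).sum_comp fun g => f' (1, g)
  have e₆ := (Equiv.subRight ((0, 1) : Torus n)).sum_comp fun g => f' (3, g)
  simp only [Equiv.subRight_apply] at e₅ e₆
  rw [Finset.sum_pi_single'] at e₄
  simp only [Finset.mem_univ, if_true] at e₄
  exact one_ne_zero (α := ZMod p) (by linear_combination e₁ + e₂ - e₃ - e₄ + e₅ - e₆)

/-! ### Moving and counting solutions with one defect -/

section Torus

variable {p n : ℕ}

/-- The maps that satisfy all equations of `torusSystem p n` where the constants `x₄(g)` are changed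
to `c g`, and the equations `x₀(g) + x₁(g - (1, 0)) = x₃(g - (0, 1))` have the defect `u g`. -/
structure SolvesTorus {p n : ℕ} (c u : Torus n → ZMod p) (f : Fin 5 × Torus n → ZMod p) :
    Prop where
  sum : ∀ g, f (0, g) + f (1, g) = f (2, g)
  twist : ∀ g, f (2, g) + f (4, g) = f (3, g)
  defect : ∀ g, f (0, g) + f (1, g - (1, 0)) + u g = f (3, g - (0, 1))
  const : ∀ g, f (4, g) = c g

theorem SolvesTorus.add {c c' u u' : Torus n → ZMod p} {f f' : Fin 5 × Torus n → ZMod p}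
    (h : SolvesTorus c u f) (h' : SolvesTorus c' u' f') :
    SolvesTorus (c + c') (u + u') (f + f') where
  sum g := by simp only [Pi.add_apply, ← h.sum, ← h'.sum]; ring
  twist g := by simp only [Pi.add_apply, ← h.twist, ← h'.twist]; ring
  defect g := by simp only [Pi.add_apply, ← h.defect, ← h'.defect]; ring
  const g := by simp only [Pi.add_apply, h.const, h'.const]

theorem SolvesTorus.neg {c u : Torus n → ZMod p} {f : Fin 5 × Torus n → ZMod p}
    (h : SolvesTorus c u f) : SolvesTorus (-c) (-u) (-f) where
  sum g := by simp only [Pi.neg_apply, ← h.sum]; ring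
  twist g := by simp only [Pi.neg_apply, ← h.twist]; ring
  defect g := by simp only [Pi.neg_apply, ← h.defect]; ring
  const g := by simp only [Pi.neg_apply, h.const]

/-- The solutions of the homogeneous system. -/
def torusKernel (p n : ℕ) : AddSubgroup (Fin 5 × Torus n → ZMod p) where
  carrier := {f | SolvesTorus 0 0 f}
  add_mem' h h' := by simpa using SolvesTorus.add h h'
  zero_mem' := by constructor <;> simp
  neg_mem' h := by simpa using SolvesTorus.neg h

/-- A homogeneous solution, supported at the positions in `s`, that moves the defect from `v`
to `v'`. -/
def IsFlow (s : Set (Torus n)) (v v' : Torus n) (d : Fin 5 × Torus n → ZMod p) : Prop :=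
  SolvesTorus 0 (Pi.single v' 1 - Pi.single v 1) d ∧ ∀ x, x.2 ∉ s → d x = 0

theorem IsFlow.trans {s : Set (Torus n)} {v v' v'' : Torus n} {d d' : Fin 5 × Torus n → ZMod p}
    (h : IsFlow s v v' d) (h' : IsFlow s v' v'' d') : IsFlow s v v'' (d + d') := by
  refine ⟨?_, fun x hx => by simp [h.2 x hx, h'.2 x hx]⟩
  have := h.1.add h'.1
  rwa [add_zero, add_comm, sub_add_sub_cancel] at this

theorem isFlow_zero (s : Set (Torus n)) (v : Torus n) :
    IsFlow s v v (0 : Fin 5 × Torus n → ZMod p) :=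
  ⟨by constructor <;> simp, fun _ _ => rfl⟩

theorem isFlow_row (v : Torus n) :
    IsFlow {v} v (v + (0, 1)) fun x : Fin 5 × Torus n =>
      (![1, 0, 1, 1, 0] x.1 : ZMod p) * (Pi.single v 1 : Torus n → ZMod p) x.2 := by
  refine ⟨?_, fun x hx => by simp [Pi.single_eq_of_ne (show x.2 ≠ v from hx)]⟩
  constructor <;> intro g <;> simp [Pi.single_apply, sub_eq_iff_eq_add]

theorem isFlow_column (v : Torus n) :
    IsFlow {v} v (v + (1, 0)) fun x : Fin 5 × Torus n =>
      (![1, -1, 0, 0, 0] x.1 : ZMod p) * (Pi.single v 1 : Torus n → ZMod p) x.2 := by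
  refine ⟨?_, fun x hx => by simp [Pi.single_eq_of_ne (show x.2 ≠ v from hx)]⟩
  constructor <;> intro g <;> simp [Pi.single_apply, sub_eq_iff_eq_add] <;> split_ifs <;> simp

theorem IsFlow.mono {s t : Set (Torus n)} {v v' : Torus n} {d : Fin 5 × Torus n → ZMod p}
    (h : IsFlow s v v' d) (hst : s ⊆ t) : IsFlow t v v' d :=
  ⟨h.1, fun x hx => h.2 x fun hs => hx (hst hs)⟩

theorem exists_isFlow_row [NeZero n] (i j j' : ZMod n) :
    ∃ d : Fin 5 × Torus n → ZMod p, IsFlow {g | g.1 = i} (i, j) (i, j') d := by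
  have key : ∀ m : ℕ, ∃ d : Fin 5 × Torus n → ZMod p,
      IsFlow {g | g.1 = i} (i, j) (i, j + m) d := by
    intro m
    induction m with
    | zero => exact ⟨0, by simpa using isFlow_zero _ _⟩
    | succ m ih =>
      obtain ⟨d, hd⟩ := ih
      have h := (isFlow_row (p := p) (i, j + (m : ZMod n))).mono
        (t := {g | g.1 = i}) (by rintro _ rfl; rfl)
      simp only [Prod.mk_add_mk, add_zero] at h
      rw [Nat.cast_succ, ← add_assoc]
      exact ⟨_, hd.trans h⟩
  simpa using key (j' - j).val

theorem exists_isFlow_column [NeZero n] (i i' j : ZMod n) :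
    ∃ d : Fin 5 × Torus n → ZMod p, IsFlow {g | g.2 = j} (i, j) (i', j) d := by
  have key : ∀ m : ℕ, ∃ d : Fin 5 × Torus n → ZMod p,
      IsFlow {g | g.2 = j} (i, j) (i + m, j) d := by
    intro m
    induction m with
    | zero => exact ⟨0, by simpa using isFlow_zero _ _⟩
    | succ m ih =>
      obtain ⟨d, hd⟩ := ih
      have h := (isFlow_column (p := p) (i + (m : ZMod n), j)).mono
        (t := {g | g.2 = j}) (by rintro _ rfl; rfl)
      simp only [Prod.mk_add_mk, add_zero] at h
      rw [Nat.cast_succ, ← add_assoc]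
      exact ⟨_, hd.trans h⟩
  simpa using key (i' - i).val

/-- The defect travels along an L-shaped path, with the first coordinate of `v` fixed and then the
second coordinate of `v'` fixed. -/
theorem exists_isFlow [NeZero n] (v v' : Torus n) :
    ∃ d : Fin 5 × Torus n → ZMod p, IsFlow {g | g.1 = v.1 ∨ g.2 = v'.2} v v' d := by
  obtain ⟨d, hd⟩ := exists_isFlow_row (p := p) v.1 v.2 v'.2
  obtain ⟨d', hd'⟩ := exists_isFlow_column (p := p) v.1 v'.1 v'.2
  exact ⟨d + d', (hd.mono fun _ => Or.inl).trans (hd'.mono fun _ => Or.inr)⟩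

theorem SolvesTorus.add_flow {c : Torus n → ZMod p} {v v' : Torus n} {s : Set (Torus n)}
    {f d : Fin 5 × Torus n → ZMod p} (hf : SolvesTorus c (Pi.single v 1) f)
    (hd : IsFlow s v v' d) : SolvesTorus c (Pi.single v' 1) (f + d) := by
  simpa using hf.add hd.1

theorem SolvesTorus.add_neg_flow {c : Torus n → ZMod p} {v v' : Torus n} {s : Set (Torus n)}
    {f d : Fin 5 × Torus n → ZMod p} (hf : SolvesTorus c (Pi.single v' 1) f)
    (hd : IsFlow s v v' d) : SolvesTorus c (Pi.single v 1) (f + -d) := by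
  simpa [sub_eq_add_neg] using hf.add hd.1.neg

/-- The equations of `torusSystem p n` become solvable once a defect is allowed at `v`. -/
theorem exists_solvesTorus [NeZero n] (v : Torus n) :
    ∃ f : Fin 5 × Torus n → ZMod p, SolvesTorus (Pi.single 0 1) (Pi.single v 1) f := by
  -- Setting `x₃ = x₄ = 1` at position `0` and all else to `0` violates only the third equation at
  -- `(0, 1)`, which reads `x₃(0)`.
  obtain ⟨d, hd⟩ := exists_isFlow (p := p) (0, 1) v
  refine ⟨_, SolvesTorus.add_flow (f := fun x : Fin 5 × Torus n =>
    (![0, 0, 0, 1, 1] x.1 : ZMod p) * (Pi.single 0 1 : Torus n → ZMod p) x.2) ?_ hd⟩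
  constructor <;> intro g <;> simp [Pi.single_apply, sub_eq_zero]

open Classical in
/-- The solutions of `torusSystem p n` with a defect at `v`. -/
noncomputable def torusSol (p n : ℕ) [NeZero p] [NeZero n] (v : Torus n) :
    Finset (Fin 5 × Torus n → ZMod p) :=
  {f | SolvesTorus (Pi.single 0 1) (Pi.single v 1) f}

theorem mem_torusSol [NeZero p] [NeZero n] {v : Torus n} {f : Fin 5 × Torus n → ZMod p} :
    f ∈ torusSol p n v ↔ SolvesTorus (Pi.single 0 1) (Pi.single v 1) f := by
  simp [torusSol]

/-- The solutions form a coset of `torusKernel`, so Lagrange's theorem applies. -/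
theorem card_torusSol_dvd [NeZero p] [NeZero n] (v : Torus n) :
    (torusSol p n v).card ∣ p ^ (5 * (n * n)) := by
  classical
  obtain ⟨f₀, hf₀⟩ := exists_solvesTorus (p := p) v
  have h : (torusSol p n v).card = Nat.card (torusKernel p n) := by
    rw [← Nat.card_eq_finsetCard]
    refine Nat.card_congr ⟨fun f => ⟨f.1 - f₀, ?_⟩, fun f => ⟨f.1 + f₀, ?_⟩, fun f => ?_, fun f => ?_⟩
    · have h := (mem_torusSol.1 f.2).add hf₀.neg
      rwa [add_neg_cancel, add_neg_cancel, ← sub_eq_add_neg] at h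
    · exact mem_torusSol.2 (by simpa using SolvesTorus.add f.2 hf₀)
    · exact Subtype.ext (sub_add_cancel _ _)
    · exact Subtype.ext (add_sub_cancel_right _ _)
  rw [h]
  have := AddSubgroup.card_addSubgroup_dvd_card (torusKernel p n)
  simpa [Nat.card_eq_fintype_card, ZMod.card] using this

end Torus

/-- The solutions with one defect are local solutions of `torusSystem p n`. -/
noncomputable def torusLocalSolutions (p n k : ℕ) [NeZero p] [NeZero n] (hk : k < n) :
    LocalSolutions (torusSystem p n) (groupTemplate (ZMod p)) k where
  Obstacle := Torus n
  sol := torusSol p n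
  Avoids K v := ∀ x ∈ K, ¬ (x.2.1 = v.1 ∨ x.2.2 = v.2)
  mono hKL h x hx := h x (hKL hx)
  exists_avoids K hK hKk := by
    -- By pigeonhole, at most `k < n` elements miss some value of each coordinate.
    have key : ∀ g : Fin 5 × Torus n → ZMod n, ∃ i, ∀ x ∈ K, g x ≠ i := by
      intro g
      by_contra! h
      have hcard : (g '' K).ncard ≤ k := (Set.ncard_image_le hK).trans hKk
      rw [show g '' K = Set.univ from Set.eq_univ_of_forall fun i => h i, Set.ncard_univ,
        Nat.card_zmod] at hcard
      omega
    obtain ⟨i, hi⟩ := key fun x => x.2.1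
    obtain ⟨j, hj⟩ := key fun x => x.2.2
    exact ⟨(i, j), fun x hx => not_or.2 ⟨hi x hx, hj x hx⟩⟩
  move {K v v'} hv hv' := by
    obtain ⟨d, hd⟩ := exists_isFlow (p := p) v v'
    let e : (Fin 5 × Torus n → ZMod p) ≃ (Fin 5 × Torus n → ZMod p) := Equiv.addRight d
    refine ⟨e, ⟨fun f hf => ?_, e.injective.injOn, fun f hf => ⟨e.symm f, ?_, ?_⟩⟩,
      fun f x hx => ?_⟩
    · exact mem_torusSol.2 ((mem_torusSol.1 hf).add_flow hd)
    · exact mem_torusSol.2 ((mem_torusSol.1 hf).add_neg_flow hd)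
    · exact e.apply_symm_apply f
    · have he : ∀ (f : Fin 5 × Torus n → ZMod p) (x), d x = 0 → e f x = f x := fun f x h => by
        simp [e, h]
      exact he f x (hd.2 x fun h =>
        h.elim (fun h => hv x hx (.inl h)) fun h => hv' x hx (.inr h))
  ty_eq _ _ _ := rfl
  map_rel {v R w} hw hv f hf := by
    have hs := mem_torusSol.1 hf
    cases R with
    | add =>
      obtain ⟨g, rfl | rfl | rfl⟩ := hw
      · exact ⟨_, _, _, rfl, hs.sum g⟩
      · exact ⟨_, _, _, rfl, hs.twist g⟩
      -- The relaxed equation at `v` contains the variable `x₀(v)`, which an avoiding tuple cannot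
      -- contain.
      · have hg : g ≠ v := by
          rintro rfl
          exact hv (0, g) List.mem_cons_self (.inl rfl)
        have h := hs.defect g
        rw [Pi.single_eq_of_ne hg, add_zero] at h
        exact ⟨_, _, _, rfl, h⟩
    | const b =>
      obtain ⟨g, rfl, rfl⟩ := hw
      exact ⟨_, rfl, hs.const g⟩

end DatalogCSP

theorem mainTheorem8 (p q : ℕ) (hp : p.Prime) (hq : q.Prime) (hpq : p ≠ q) :
    ¬ DatalogCSP.CSPLeDL (DatalogCSP.groupTemplate (ZMod p)) (DatalogCSP.groupTemplate (ZMod q)) := by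
  rintro ⟨M, hM, φ, υ, h⟩
  have : Fact q.Prime := ⟨hq⟩
  have : NeZero p := ⟨hp.ne_zero⟩
  obtain ⟨k, hk⟩ := φ.exists_widthLE hM
  have hfinA : Finite (DatalogCSP.groupTemplate (ZMod p)).El := inferInstanceAs (Finite (ZMod p))
  have hfinX : Finite (DatalogCSP.torusSystem p (k + 1)).El :=
    inferInstanceAs (Finite (Fin 5 × DatalogCSP.Torus (k + 1)))
  -- Completeness is used for one instance only: the template itself.
  have hA := (h _ hfinA).1 ⟨id, fun _ => rfl, fun _ _ hw => by simpa using hw⟩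
  refine (h _ hfinX).2 (DatalogCSP.not_maps_torusSystem hp)
    ((DatalogCSP.torusLocalSolutions p (k + 1) k k.lt_succ_self).maps (fun v hv => ?_) φ hk υ hA)
  have hdvd := ((ZMod.natCast_eq_zero_iff _ _).1 hv).trans (DatalogCSP.card_torusSol_dvd v)
  exact hpq ((Nat.prime_dvd_prime_iff_eq hq hp).1 (hq.dvd_of_dvd_pow hdvd)).symm
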